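/- Let $N\in\mathbb{N}$, let $\mathbb{H}$ be a complex Hilbert space of dimension $2^N$, and let $c_1,\dots,c_N$ be operators on $\mathbb{H}$ that satisfy the canonical anti-commutation relations $\{c_i,c_j\}=\{c_i^*,c_j^*\}=0$ and $\{c_i,c_j^*\}=\delta_{ij}\mathbb{I}$, where $\{u,v\}=uv+vu$. Let $\mathbf{H}\in\mathbb{C}^{N\times N}$ be Hermitian, with a diagonalization $\mathbf{H}=\mathbf{U}\,\mathrm{Diag}(\lambda_k)\,\mathbf{U}^*$, where $\mathbf{U}$ is unitary and $\lambda_1,\dots,\lambda_N\in\mathbb{R}$. Put $$H=\sum_{i,j=1}^N c_i^*\,\mathbf{H}_{ij}\,c_j,\qquad b_k=\sum_{j=1}^N\overline{\mathbf{U}_{jk}}\,c_j\quad(1\le k\le N).$$ Let $\beta>0$ and $\mu\ge 0$, and let $$\rho=\frac1Z\exp\Big(-\beta\Big(H-\mu\sum_{j=1}^N b_j^*b_j\Big)\Big),\qquad Z=\mathrm{tr}\,\exp\Big(-\beta\Big(H-\mu\sum_{j=1}^N b_j^*b_j\Big)\Big).$$ For a self-adjoint operator $A$ and $x\in\mathbb{R}$,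 let $1_{\{x\}}(A)$ be the orthogonal projection onto $\ker(A-x)$. Then: 1. $\rho$ is a mixed state, i.e. it is positive and $\mathrm{tr}\,\rho=1$. 2. Each $N_i=c_i^*c_i$ is an orthogonal projector, and Born's rule $\mathbb{P}(X_{N_i,\rho}=x)=\mathrm{tr}\big[\rho\,1_{\{x\}}(N_i)\big]$ determines a unique law on the spectrum of $N_i$, under which $X_{N_i,\rho}\in\{0,1\}$ almost surely. 3. The operators $N_1,\dots,N_N$ commute pairwise, and Born's rule $$\mathbb{P}(X_{N_1,\rho}=x_1,\dots,X_{N_N,\rho}=x_N)=\mathrm{tr}\big[\rho\,1_{\{x_1\}}(N_1)\cdots 1_{\{x_N\}}(N_N)\big]$$ determines a unique law on the product of the spectra. It is the law of a vector that is almost surely Boolean, and its $i$-th marginal is the law of $X_{N_i,\rho}$ in 2. 4. The point process $Y=\{i\in[N]: X_{N_i,\rho}=1\}$ obtained from this joint measurement is determinantal with correlation kernel $$\mathbf{K}=\mathbf{U}\,\mathrm{Diag}\big(\sigma(-\beta(\lambda_k-\mu))\big)\,\mathbf{U}^*,\qquad \sigma(x)=\frac{1}{1+e^{-x}},$$ that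 is, $\mathbb{P}(S\subseteq Y)=\det\big([\mathbf{K}_{ij}]_{i,j\in S}\big)$ for every $S\subseteq[N]$, with the convention that the determinant of the empty matrix is $1$. -/

import Mathlib

open MeasureTheory

noncomputable section

/-- A probability measure `P` over the subsets of `[N]` (a point process) is the determinantal point
process of marginal kernel `K`: `P(S ⊆ Y) = det K_S` for every `S ⊆ [N]`. -/
def IsDPP {N : ℕ} (K : Matrix (Fin N) (Fin N) ℂ) (P : Measure (Set (Fin N))) : Prop :=
  IsProbabilityMeasure P ∧
    ∀ S : Finset (Fin N),
      ((P.real {Y : Set (Fin N) | (S : Set (Fin N)) ⊆ Y} : ℝ) : ℂ) =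
        (K.submatrix (fun i : S => (i : Fin N)) (fun j : S => (j : Fin N))).det

namespace Fermion

variable {E : Type*} [NormedAddCommGroup E] [InnerProductSpace ℂ E] [FiniteDimensional ℂ E]
  [CompleteSpace E]

/-- The trace of an operator on a finite-dimensional Hilbert space. -/
def tr (A : E →L[ℂ] E) : ℂ := LinearMap.trace ℂ E (A : E →ₗ[ℂ] E)

/-- The spectral projector `1_{x}(A)` of an observable (self-adjoint operator) `A`: the orthogonal
projection onto the eigenspace `ker (A - x)`, which is `0` when `x` is not an eigenvalue. -/
def specProj (A : E →L[ℂ] E) (x : ℝ) : E →L[ℂ] E :=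
  (Module.End.eigenspace (A : E →ₗ[ℂ] E) (x : ℂ)).starProjection

/-- A mixed state: a positive operator of trace one. -/
def IsState (ρ : E →L[ℂ] E) : Prop := ρ.IsPositive ∧ tr ρ = 1

/-- Born's rule: `ν` is the law of the outcome `X_{A,ρ}` of measuring the observable `A` in `ρ`, a
probability measure on the eigenvalues of `A` with `P(X = x) = tr (ρ 1_{x}(A))`. -/
def IsBornLaw (ρ A : E →L[ℂ] E) (ν : Measure ℝ) : Prop :=
  IsProbabilityMeasure ν ∧
    (∀ᵐ x : ℝ ∂ν, Module.End.HasEigenvalue (A : E →ₗ[ℂ] E) (x : ℂ)) ∧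
    ∀ x : ℝ, ((ν.real {x} : ℝ) : ℂ) = tr (ρ * specProj A x)

/-- Born's rule for a family of commuting observables `A₁, …, A_p`: `ν` is the law of the random
vector of outcomes, a probability measure on the product of the spectra, with
`P(X₁ = x₁, …, X_p = x_p) = tr (ρ 1_{x₁}(A₁) ⋯ 1_{x_p}(A_p))`. -/
def IsJointBornLaw {p : ℕ} (ρ : E →L[ℂ] E) (A : Fin p → E →L[ℂ] E)
    (ν : Measure (Fin p → ℝ)) : Prop :=
  IsProbabilityMeasure ν ∧
    (∀ᵐ x ∂ν, ∀ i, Module.End.HasEigenvalue (A i : E →ₗ[ℂ] E) (x i : ℂ)) ∧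
    ∀ x : Fin p → ℝ,
      ((ν.real {x} : ℝ) : ℂ) = tr (ρ * (List.ofFn fun i => specProj (A i) (x i)).prod)

/-- The canonical anti-commutation relations (`star` is the Hilbert space adjoint). -/
structure IsCAR {N : ℕ} (c : Fin N → E →L[ℂ] E) : Prop where
  anticomm : ∀ i j, c i * c j + c j * c i = 0
  anticomm_star : ∀ i j, star (c i) * star (c j) + star (c j) * star (c i) = 0
  anticomm_mixed : ∀ i j, c i * star (c j) + star (c j) * c i = if i = j then 1 else 0

/-- The number operator `N_i = c_i^* c_i`. -/
def number {N : ℕ} (c : Fin N → E →L[ℂ] E) (i : Fin N) : E →L[ℂ] E := star (c i) * c i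

/-- The quadratic Hamiltonian `H = ∑_{i,j} c_i^* H_{ij} c_j`. -/
def hamiltonian {N : ℕ} (c : Fin N → E →L[ℂ] E) (H : Matrix (Fin N) (Fin N) ℂ) : E →L[ℂ] E :=
  ∑ i, ∑ j, H i j • (star (c i) * c j)

/-- `b_k = ∑_j conj (u_k)_j c_j`, with `u_k` the `k`-th column of `U`. -/
def rotated {N : ℕ} (c : Fin N → E →L[ℂ] E) (U : Matrix (Fin N) (Fin N) ℂ) (k : Fin N) :
    E →L[ℂ] E :=
  ∑ j, star (U j k) • c j

/-- The operator `exp (-β (H - μ ∑_j b_j^* b_j))`. -/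
def gibbsWeight {N : ℕ} (β μ : ℝ) (H : E →L[ℂ] E) (b : Fin N → E →L[ℂ] E) : E →L[ℂ] E :=
  NormedSpace.exp (-(β : ℂ) • (H - (μ : ℂ) • ∑ j, star (b j) * b j))

/-- The Gibbs state `ρ = Z⁻¹ exp (-β (H - μ ∑_j b_j^* b_j))`, with
`Z = tr exp (-β (H - μ ∑_j b_j^* b_j))`. -/
def gibbsState {N : ℕ} (β μ : ℝ) (H : E →L[ℂ] E) (b : Fin N → E →L[ℂ] E) : E →L[ℂ] E :=
  (tr (gibbsWeight β μ H b))⁻¹ • gibbsWeight β μ H b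

end Fermion

end

/-! ### Wick's theorem in an abstract algebra. -/

section Wick

variable {A : Type*} [Ring A] [Algebra ℂ A]

/-! Diagonalizing the Hamiltonian turns the Gibbs weight into $W=\exp(-\sum_k a_k b_k^*b_k)$ with
$a_k=\beta(\lambda_k-\mu)$. Each $b_k^*$ shifts the $k$-th number operator by one, so
$Wb_k^*=e^{-a_k}b_k^*W$, and cyclicity of the trace gives the KMS relation
$T(b_k^*X)=e^{-a_k}T(Xb_k^*)$ for $T(X)=\mathrm{tr}(WX)$ (`IsCAR.exp_mul_star`). In `wick`, $b_k^*$
is anticommuted back through $X$. It returns with sign $-1$ plus contractions, so solving for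
$T(b_k^*X)$ yields the factor $e^{-a_k}/(1+e^{-a_k})=\sigma(-a_k)$, and the recursion is a Laplace
expansion. After normal ordering, `IsCAR.tr_gibbs_mul_prod_number` reads
$\mathrm{tr}(\rho\prod_{i\in S}N_i)=\det\mathbf K_S$. On the probabilistic side, commuting
projections make the Born weights nonnegative. Summing out the outcomes outside $S$ by
$1=N_i+(1-N_i)$ (`IsJointBornLaw.measureReal_cylinder`) identifies that trace with $\mathbb
P(S\subseteq Y)$. -/

theorem List.prod_ofFn_mul_of_anticomm {n : ℕ} (b : A) (v : Fin n → A)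
    (h : ∀ m, v m * b + b * v m = 0) :
    (List.ofFn v).prod * b = (-1 : ℂ) ^ n • (b * (List.ofFn v).prod) := by
  induction n with
  | zero => simp
  | succ n ih =>
    have h0 : v 0 * b = -(b * v 0) := eq_neg_of_add_eq_zero_left (h 0)
    rw [List.ofFn_succ, List.prod_cons, mul_assoc, ih _ fun m => h m.succ, mul_smul_comm,
      ← mul_assoc, h0, pow_succ, mul_smul, ← mul_assoc]
    simp

theorem List.prod_reverse_ofFn_succ {A : Type*} [Ring A] {n : ℕ} (u : Fin (n + 1) → A) :
    (List.ofFn u).reverse.prod = (List.ofFn fun i : Fin n => u i.succ).reverse.prod * u 0 := by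
  simp [List.ofFn_succ]

/-- Moving an operator through a product with which it anticommutes factor by factor, up to
scalars. -/
theorem List.prod_reverse_ofFn_mul {n : ℕ} (b : A) (u : Fin (n + 1) → A) (κ : Fin (n + 1) → ℂ)
    (h : ∀ m, u m * b + b * u m = κ m • 1) :
    (List.ofFn u).reverse.prod * b = (-1 : ℂ) ^ (n + 1) • (b * (List.ofFn u).reverse.prod) +
      ∑ m : Fin (n + 1), ((-1) ^ (m : ℕ) * κ m) •
        (List.ofFn fun i => u (m.succAbove i)).reverse.prod := by
  induction n with
  | zero =>
    have h0 : u 0 * b = κ 0 • 1 - b * u 0 := eq_sub_of_add_eq (h 0)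
    simp [h0, sub_eq_neg_add]
  | succ n ih =>
    have h0 : u 0 * b = κ 0 • 1 - b * u 0 := eq_sub_of_add_eq (h 0)
    have ih' := ih (fun i => u i.succ) (fun i => κ i.succ) fun m => h m.succ
    -- Deleting a successor index keeps `u 0`, the rightmost factor of the reversed product. The
    -- term `m = 0` is the contraction with `u 0` itself.
    have hs (m : Fin (n + 1)) : (List.ofFn fun i => u (m.succ.succAbove i)).reverse.prod =
        (List.ofFn fun i => u (m.succAbove i).succ).reverse.prod * u 0 := by
      rw [List.prod_reverse_ofFn_succ]
      simp
    have h1 (m : Fin (n + 1)) :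
        (-1 : ℂ) ^ (m.succ : ℕ) * κ m.succ = -((-1) ^ (m : ℕ) * κ m.succ) := by
      rw [Fin.val_succ]
      ring
    have h2 : (-1 : ℂ) ^ (n + 1 + 1) = -(-1) ^ (n + 1) := by ring
    rw [List.prod_reverse_ofFn_succ, mul_assoc, h0, mul_sub, ← mul_assoc _ b, ih',
      Fin.sum_univ_succ (n := n + 1)]
    simp only [hs, h1, h2, Fin.zero_succAbove, add_mul, Finset.sum_mul, smul_mul_assoc,
      mul_smul_comm, mul_one, Fin.val_zero, pow_zero, one_mul, neg_smul, Finset.sum_neg_distrib,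
      mul_assoc]
    abel

/-- **Wick's theorem**: a linear functional that satisfies the KMS condition evaluates normal
ordered products to determinants. -/
theorem wick {ι κ : Type*} [Fintype κ] (T : A →ₗ[ℂ] ℂ) (cs c : ι → A) (bs : κ → A)
    (w V : ι → κ → ℂ) (e : κ → ℂ) (he : ∀ k, 1 + e k ≠ 0)
    (hT : ∀ k X, T (bs k * X) = e k * T (X * bs k))
    (hcs : ∀ i, cs i = ∑ k, w i k • bs k)
    (hanti : ∀ i k, cs i * bs k + bs k * cs i = 0)
    (hmix : ∀ i k, c i * bs k + bs k * c i = V i k • 1)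
    {n : ℕ} (f g : Fin n → ι) :
    T ((List.ofFn fun i => cs (f i)).prod * (List.ofFn fun i => c (g i)).reverse.prod) =
      (Matrix.of fun a b => ∑ k, w (f a) k * (e k / (1 + e k)) * V (g b) k).det * T 1 := by
  induction n with
  | zero => simp
  | succ n ih =>
    set C : A := (List.ofFn fun i : Fin n => cs (f i.succ)).prod with hC
    set X : A := C * (List.ofFn fun i => c (g i)).reverse.prod with hX
    set t : Fin (n + 1) → ℂ := fun m =>
      T (C * (List.ofFn fun i => c (g (m.succAbove i))).reverse.prod) with ht
    have key (k : κ) : T (bs k * X) =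
        ∑ m : Fin (n + 1), (-1) ^ (m : ℕ) * ((e k / (1 + e k)) * V (g m) k) * t m := by
      have h1 : X * bs k = -(bs k * X) + ∑ m : Fin (n + 1), ((-1) ^ (m : ℕ) * V (g m) k) •
          (C * (List.ofFn fun i => c (g (m.succAbove i))).reverse.prod) := by
        rw [hX, mul_assoc, List.prod_reverse_ofFn_mul (bs k) (fun i => c (g i)) (fun i => V (g i) k)
          fun m => hmix _ _, mul_add, mul_smul_comm, ← mul_assoc C, hC,
          List.prod_ofFn_mul_of_anticomm _ _ fun m => hanti _ _, smul_mul_assoc, smul_smul,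
          Finset.mul_sum, mul_assoc]
        congr 1
        -- There are `n` sign changes from `C` and `n + 1` from the reversed product: an odd total.
        · rw [← pow_add, Odd.neg_one_pow ⟨n, by ring⟩, neg_one_smul]
        · simp only [mul_smul_comm]
      have h2 := hT k X
      rw [h1, map_add, map_neg, map_sum] at h2
      simp only [map_smul, smul_eq_mul] at h2
      -- KMS gives `(1 + e k) * T (bs k * X) = e k * (contractions)`.
      have h3 : T (bs k * X) =
          e k / (1 + e k) * ∑ m : Fin (n + 1), (-1) ^ (m : ℕ) * V (g m) k * t m := by
        have := he k
        field_simp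
        linear_combination h2
      rw [h3, Finset.mul_sum]
      exact Finset.sum_congr rfl fun m _ => by ring
    -- Expanding the first creation operator in the `bs k` matches the Laplace expansion along row
    -- `0`.
    rw [List.ofFn_succ, List.prod_cons, mul_assoc, ← hC, ← hX, hcs, Finset.sum_mul, map_sum,
      Matrix.det_succ_row_zero, Finset.sum_mul]
    simp only [smul_mul_assoc, map_smul, key, smul_eq_mul, Finset.mul_sum]
    rw [Finset.sum_comm]
    refine Finset.sum_congr rfl fun m _ => ?_
    have := ih (fun i => f i.succ) (fun i => g (m.succAbove i))
    simp only [ht, hC, this, Matrix.of_apply, Matrix.submatrix, Finset.mul_sum, Finset.sum_mul]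
    exact Finset.sum_congr rfl fun k _ => by ring

/-- Normal ordering of a product of number operators. -/
theorem List.prod_ofFn_number {A ι : Type*} [Ring A] (cs c : ι → A)
    (h1 : ∀ i j, c i * c j + c j * c i = 0) (h2 : ∀ i j, i ≠ j → c i * cs j + cs j * c i = 0)
    {n : ℕ} (f : Fin n → ι) (hf : Function.Injective f) :
    (List.ofFn fun i => cs (f i) * c (f i)).prod =
      (List.ofFn fun i => cs (f i)).prod * (List.ofFn fun i => c (f i)).reverse.prod := by
  -- Two sign changes cancel, so normal ordering costs no sign; each annihilator travels to the far
  -- right, whence the reversed order.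
  have comm (i j : ι) (hij : i ≠ j) : Commute (c i) (cs j * c j) := by
    have e1 := eq_neg_of_add_eq_zero_left (h1 i j)
    have e2 := eq_neg_of_add_eq_zero_left (h2 i j hij)
    rw [commute_iff_eq, ← mul_assoc, e2, neg_mul, mul_assoc, e1, mul_neg, neg_neg, mul_assoc]
  induction n with
  | zero => simp
  | succ n ih =>
    have ih' := ih (fun i => f i.succ) (hf.comp (Fin.succ_injective n))
    have hc : Commute (c (f 0)) (List.ofFn fun i : Fin n => cs (f i.succ) * c (f i.succ)).prod := by
      refine Commute.list_prod_right _ _ fun x hx => ?_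
      obtain ⟨i, rfl⟩ := (List.mem_ofFn' _ _).1 hx
      exact comm _ _ fun h => absurd (hf h) (Fin.succ_ne_zero i).symm
    rw [List.ofFn_succ, List.prod_cons, mul_assoc, hc.eq, ih', List.ofFn_succ, List.prod_cons,
      List.prod_reverse_ofFn_succ]
    simp only [mul_assoc]

end Wick

namespace Fermion

section Trace

open scoped ComplexOrder

variable {E : Type*} [NormedAddCommGroup E] [InnerProductSpace ℂ E]

theorem tr_mul_comm (A B : E →L[ℂ] E) : tr (A * B) = tr (B * A) :=
  LinearMap.trace_mul_comm ℂ (A : E →ₗ[ℂ] E) (B : E →ₗ[ℂ] E)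

theorem tr_smul (z : ℂ) (A : E →L[ℂ] E) : tr (z • A) = z * tr A := by
  simp [tr]

/-- The linear functional `X ↦ tr (A X)`. -/
noncomputable def trMulLeft (A : E →L[ℂ] E) : (E →L[ℂ] E) →ₗ[ℂ] ℂ where
  toFun X := tr (A * X)
  map_add' X Y := by simp [tr, mul_add]
  map_smul' z X := by simp [tr]

theorem trMulLeft_apply (A X : E →L[ℂ] E) : trMulLeft A X = tr (A * X) := rfl

theorem tr_nonneg {A : E →L[ℂ] E} (hA : A.IsPositive) : 0 ≤ tr A :=
  hA.toLinearMap.trace_nonneg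

end Trace

variable {E : Type*} [NormedAddCommGroup E] [InnerProductSpace ℂ E] [CompleteSpace E]

/-! ### Positivity and normalization of Gibbs states. -/

section GibbsState

open scoped ComplexOrder

/-- In an orthonormal basis the trace is $\sum_i\|Xv_i\|^2$, and an invertible $X$ kills no $v_i$.
-/
theorem tr_star_mul_self_pos [FiniteDimensional ℂ E] [Nontrivial E] {X : E →L[ℂ] E}
    (hX : IsUnit X) :
    0 < tr (star X * X) := by
  have h0 : Nonempty (Fin (Module.finrank ℂ E)) := ⟨⟨0, Module.finrank_pos⟩⟩
  rw [tr, LinearMap.trace_eq_sum_inner _ (stdOrthonormalBasis ℂ E)]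
  refine Finset.sum_pos (fun i _ => ?_) Finset.univ_nonempty
  set v := stdOrthonormalBasis ℂ E i with hv
  have hv0 : v ≠ 0 := (stdOrthonormalBasis ℂ E).orthonormal.ne_zero i
  have hXv : X v ≠ 0 := by
    obtain ⟨Y, hY⟩ := hX.exists_left_inv
    intro h
    apply hv0
    have := congrArg (fun Z : E →L[ℂ] E => Z v) hY
    simpa [h] using this.symm
  have : inner ℂ v ((star X * X : E →L[ℂ] E) v) = ((‖X v‖ ^ 2 : ℝ) : ℂ) := by
    rw [ContinuousLinearMap.star_eq_adjoint, mul_apply_eq_comp,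
      ContinuousLinearMap.adjoint_inner_right, inner_self_eq_norm_sq_to_K]
    simp
  show 0 < inner ℂ v ((star X * X : E →L[ℂ] E) v)
  rw [this]
  exact_mod_cast pow_pos (norm_pos_iff.2 hXv) 2

/-- By cyclicity and $P^2=P$, the trace is that of the positive operator $P\rho P$. -/
theorem tr_mul_nonneg {ρ P : E →L[ℂ] E} (hρ : ρ.IsPositive) (hP : IsStarProjection P) :
    0 ≤ tr (ρ * P) := by
  have h1 : tr (ρ * P) = tr (P * ρ * star P) := by
    rw [hP.isSelfAdjoint.star_eq, tr_mul_comm (P * ρ), ← mul_assoc, hP.isIdempotentElem.eq,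
      tr_mul_comm]
  rw [h1]
  exact tr_nonneg (hρ.conj_adjoint P)

theorem exists_exp_eq_star_mul_self {G : E →L[ℂ] E} (hG : IsSelfAdjoint G) :
    ∃ X : E →L[ℂ] E, IsUnit X ∧ NormedSpace.exp G = star X * X := by
  let : NormedAlgebra ℚ (E →L[ℂ] E) := NormedAlgebra.restrictScalars ℚ ℂ _
  refine ⟨NormedSpace.exp ((2⁻¹ : ℝ) • G), NormedSpace.isUnit_exp _, ?_⟩
  have : IsSelfAdjoint ((2⁻¹ : ℝ) • G) := (IsSelfAdjoint.all (2⁻¹ : ℝ)).smul hG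
  rw [this.exp.star_eq, ← NormedSpace.exp_add_of_commute (Commute.refl _), ← add_smul]
  norm_num

theorem isState_normalize_exp [FiniteDimensional ℂ E] [Nontrivial E] {G : E →L[ℂ] E}
    (hG : IsSelfAdjoint G) :
    tr (NormedSpace.exp G) ≠ 0 ∧
      IsState ((tr (NormedSpace.exp G))⁻¹ • NormedSpace.exp G) := by
  obtain ⟨X, hX, h⟩ := exists_exp_eq_star_mul_self hG
  have hpos : 0 < tr (NormedSpace.exp G) := h ▸ tr_star_mul_self_pos hX
  refine ⟨hpos.ne', ?_, ?_⟩
  · refine ContinuousLinearMap.IsPositive.smul_of_nonneg ?_ (inv_nonneg.2 hpos.le)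
    rw [h]
    exact ContinuousLinearMap.isPositive_adjoint_comp_self X
  · rw [tr_smul, inv_mul_cancel₀ hpos.ne']

/-! ### Rotated modes, number operators and the KMS relation. -/

section CAR

variable {N : ℕ} {c : Fin N → E →L[ℂ] E} {U : Matrix (Fin N) (Fin N) ℂ}

theorem star_rotated (c : Fin N → E →L[ℂ] E) (U : Matrix (Fin N) (Fin N) ℂ) (k : Fin N) :
    star (rotated c U k) = ∑ j, U j k • star (c j) := by
  simp [rotated, star_sum, star_smul]

/-- Unitarity inverts the rotation, expressing $c_i^*$ in the modes where the KMS relation is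
diagonal. -/
theorem star_eq_sum_star_rotated (c : Fin N → E →L[ℂ] E)
    (hU : U ∈ Matrix.unitaryGroup (Fin N) ℂ) (i : Fin N) :
    star (c i) = ∑ k, star (U i k) • star (rotated c U k) := by
  have h (j : Fin N) : ∑ k, U j k * star (U i k) = (1 : Matrix (Fin N) (Fin N) ℂ) j i := by
    rw [← (Matrix.mem_unitaryGroup_iff).1 hU, Matrix.mul_apply]
    rfl
  simp only [star_rotated, Finset.smul_sum, smul_smul]
  rw [Finset.sum_comm]
  simp only [← Finset.sum_smul]
  simp_rw [mul_comm (star _) (U _ _), h, Matrix.one_apply]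
  simp

theorem IsCAR.mul_star_rotated (hc : IsCAR c) (U : Matrix (Fin N) (Fin N) ℂ) (j k : Fin N) :
    c j * star (rotated c U k) + star (rotated c U k) * c j = U j k • 1 := by
  simp only [star_rotated, Finset.mul_sum, Finset.sum_mul, mul_smul_comm, smul_mul_assoc,
    ← Finset.sum_add_distrib, ← smul_add, hc.anticomm_mixed]
  simp

theorem IsCAR.star_mul_star_rotated (hc : IsCAR c) (U : Matrix (Fin N) (Fin N) ℂ) (j k : Fin N) :
    star (c j) * star (rotated c U k) + star (rotated c U k) * star (c j) = 0 := by
  simp only [star_rotated, Finset.mul_sum, Finset.sum_mul, mul_smul_comm, smul_mul_assoc,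
    ← Finset.sum_add_distrib, ← smul_add, hc.anticomm_star]
  simp

theorem IsCAR.rotated (hc : IsCAR c) (hU : U ∈ Matrix.unitaryGroup (Fin N) ℂ) :
    IsCAR (rotated c U) := by
  have h2 : ∀ i j, star (Fermion.rotated c U i) * star (Fermion.rotated c U j) +
      star (Fermion.rotated c U j) * star (Fermion.rotated c U i) = 0 := by
    intro i j
    rw [star_rotated c U i]
    simp only [Finset.mul_sum, Finset.sum_mul, mul_smul_comm, smul_mul_assoc,
      ← Finset.sum_add_distrib, ← smul_add, hc.star_mul_star_rotated]
    simp
  refine ⟨fun i j => ?_, h2, fun i j => ?_⟩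
  · have := congrArg star (h2 j i)
    simpa only [star_add, star_mul, star_star, star_zero] using this
  · have h : ∑ l, star (U l i) * U l j = (1 : Matrix (Fin N) (Fin N) ℂ) i j := by
      rw [← (Matrix.mem_unitaryGroup_iff').1 hU, Matrix.mul_apply]
      rfl
    rw [Fermion.rotated]
    simp only [Finset.mul_sum, Finset.sum_mul, mul_smul_comm, smul_mul_assoc,
      ← Finset.sum_add_distrib, ← smul_add, hc.mul_star_rotated, smul_smul, ← Finset.sum_smul, h,
      Matrix.one_apply]
    split_ifs <;> simp

theorem _root_.Matrix.mul_diagonal_mul_conjTranspose_apply {ι R : Type*} [Fintype ι]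
    [DecidableEq ι] [Semiring R] [StarRing R] (U : Matrix ι ι R) (d : ι → R) (i j : ι) :
    (U * Matrix.diagonal d * U.conjTranspose) i j = ∑ k, U i k * d k * star (U j k) := by
  rw [Matrix.mul_apply]
  simp only [Matrix.mul_diagonal, Matrix.conjTranspose_apply]

theorem hamiltonian_diagonalized (c : Fin N → E →L[ℂ] E) (U : Matrix (Fin N) (Fin N) ℂ)
    (lam : Fin N → ℂ) :
    hamiltonian c (U * Matrix.diagonal lam * U.conjTranspose) =
      ∑ k, lam k • number (rotated c U) k := by
  simp only [hamiltonian, number, star_rotated,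
    Matrix.mul_diagonal_mul_conjTranspose_apply, Finset.sum_smul]
  simp only [rotated, Finset.mul_sum, Finset.sum_mul, mul_smul_comm, smul_mul_assoc,
    Finset.smul_sum, smul_smul]
  conv_rhs =>
    rw [Finset.sum_comm]
    enter [2, i]
    rw [Finset.sum_comm]
  rw [Finset.sum_comm]
  refine Finset.sum_congr rfl fun i _ => Finset.sum_congr rfl fun j _ =>
    Finset.sum_congr rfl fun k _ => ?_
  ring_nf

theorem isSelfAdjoint_number (c : Fin N → E →L[ℂ] E) (i : Fin N) : IsSelfAdjoint (number c i) :=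
  IsSelfAdjoint.star_mul_self _

theorem IsCAR.isStarProjection_number (hc : IsCAR c) (i : Fin N) :
    IsStarProjection (number c i) := by
  refine ⟨?_, isSelfAdjoint_number c i⟩
  have h1 : c i * c i = 0 := by
    have := hc.anticomm i i
    rw [← two_smul ℂ] at this
    simpa using this
  have h2 : c i * star (c i) = 1 - star (c i) * c i := by
    simpa using eq_sub_of_add_eq (hc.anticomm_mixed i i)
  rw [IsIdempotentElem, number, mul_assoc, ← mul_assoc (c i), h2, sub_mul, one_mul, mul_assoc, h1,
    mul_zero, sub_zero]

/-- Infinitesimal form of the KMS relation: a creation operator raises its own occupation number by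
one. -/
theorem IsCAR.number_mul_star (hc : IsCAR c) (j k : Fin N) :
    number c j * star (c k) = star (c k) * (number c j + if j = k then 1 else 0) := by
  have h1 := eq_sub_of_add_eq (hc.anticomm_mixed j k)
  have h2 := eq_neg_of_add_eq_zero_left (hc.anticomm_star j k)
  rw [number, mul_assoc, h1, mul_sub, ← mul_assoc, h2, mul_add, neg_mul, sub_neg_eq_add, add_comm,
    mul_assoc]
  split_ifs with h
  · rw [h]
  · simp

theorem IsCAR.commute_number (hc : IsCAR c) (i j : Fin N) :
    Commute (number c i) (number c j) := by
  obtain rfl | hij := eq_or_ne i j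
  · exact Commute.refl _
  have h1 : Commute (number c i) (star (c j)) := by
    have := hc.number_mul_star i j
    rwa [if_neg hij, add_zero] at this
  have h2 : Commute (number c i) (c j) := by
    have := h1.star_star
    rwa [(isSelfAdjoint_number c i).star_eq, star_star] at this
  exact h1.mul_right h2

/-- The KMS relation for the creation operators. -/
theorem IsCAR.exp_mul_star (hc : IsCAR c) (a : Fin N → ℝ) (k : Fin N) :
    NormedSpace.exp (-∑ j, ((a j : ℝ) : ℂ) • number c j) * star (c k) =
      (Real.exp (-a k) : ℂ) •
        (star (c k) * NormedSpace.exp (-∑ j, ((a j : ℝ) : ℂ) • number c j)) := by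
  set G : E →L[ℂ] E := -∑ j, ((a j : ℝ) : ℂ) • number c j with hG
  have h1 : G * star (c k) = star (c k) * (G + (-a k : ℂ) • 1) := by
    simp only [hG, neg_mul, Finset.sum_mul, smul_mul_assoc, hc.number_mul_star, mul_add, smul_add,
      Finset.sum_add_distrib, mul_neg, neg_add, Finset.mul_sum, mul_smul_comm]
    simp
  -- An intertwining relation passes to exponentials, and the scalar shift $-a_k$ becomes the factor
  -- $e^{-a_k}$.
  have h2 : SemiconjBy (star (c k)) (G + (-a k : ℂ) • 1) G := h1.symm
  have h3 : Commute G ((-a k : ℂ) • (1 : E →L[ℂ] E)) := (Commute.one_right G).smul_right _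
  have h4 : NormedSpace.exp ((-a k : ℂ) • (1 : E →L[ℂ] E)) = (Real.exp (-a k) : ℂ) • 1 := by
    have := NormedSpace.algebraMap_exp_comm (𝕂 := ℂ) (𝔸 := E →L[ℂ] E) (-a k : ℂ)
    rw [Algebra.algebraMap_eq_smul_one, Algebra.algebraMap_eq_smul_one, ← Complex.exp_eq_exp_ℂ]
      at this
    rw [← this]
    push_cast
    rfl
  let : NormedAlgebra ℚ (E →L[ℂ] E) := NormedAlgebra.restrictScalars ℚ ℂ _
  rw [← h2.exp_right.eq, NormedSpace.exp_add_of_commute h3, h4]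
  simp

theorem gibbsWeight_diagonalized (c : Fin N → E →L[ℂ] E) (U : Matrix (Fin N) (Fin N) ℂ)
    (lam : Fin N → ℝ) (β μ : ℝ) :
    gibbsWeight β μ (hamiltonian c (U * Matrix.diagonal (fun k => (lam k : ℂ)) * U.conjTranspose))
        (rotated c U) =
      NormedSpace.exp (-∑ k, ((β * (lam k - μ) : ℝ) : ℂ) • number (rotated c U) k) := by
  rw [gibbsWeight, hamiltonian_diagonalized]
  congr 1
  simp only [number, Finset.smul_sum, ← Finset.sum_sub_distrib, ← sub_smul, smul_smul]
  rw [← Finset.sum_neg_distrib]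
  refine Finset.sum_congr rfl fun k _ => ?_
  rw [← neg_smul]
  congr 1
  push_cast
  ring

theorem isSelfAdjoint_neg_sum_number (b : Fin N → E →L[ℂ] E) (a : Fin N → ℝ) :
    IsSelfAdjoint (-∑ k, (a k : ℂ) • number b k) := by
  refine IsSelfAdjoint.neg (isSelfAdjoint_sum _ fun k _ => ?_)
  exact IsSelfAdjoint.smul (Complex.conj_ofReal _) (isSelfAdjoint_number b k)

end CAR

/-- The Fermi-Dirac kernel gives the correlations of the number operators in the Gibbs state. -/
theorem IsCAR.tr_gibbs_mul_prod_number {N : ℕ} {c : Fin N → E →L[ℂ] E} (hc : IsCAR c)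
    {U : Matrix (Fin N) (Fin N) ℂ} (hU : U ∈ Matrix.unitaryGroup (Fin N) ℂ) (a : Fin N → ℝ)
    {n : ℕ} (f : Fin n → Fin N) (hf : Function.Injective f) :
    tr (NormedSpace.exp (-∑ k, (a k : ℂ) • number (Fermion.rotated c U) k) *
        (List.ofFn fun i => number c (f i)).prod) =
      ((U * Matrix.diagonal (fun k => ((Real.sigmoid (-a k) : ℝ) : ℂ)) *
          U.conjTranspose).submatrix f f).det *
        tr (NormedSpace.exp (-∑ k, (a k : ℂ) • number (Fermion.rotated c U) k)) := by
  set W := NormedSpace.exp (-∑ k, (a k : ℂ) • number (Fermion.rotated c U) k) with hW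
  have hpos (k : Fin N) : (0 : ℝ) < 1 + Real.exp (-a k) := by positivity
  have key := wick (trMulLeft W) (fun i => star (c i)) c (fun k => star (Fermion.rotated c U k))
    (fun i k => star (U i k)) U (fun k => (Real.exp (-a k) : ℂ))
    (fun k => by exact_mod_cast (hpos k).ne')
    (fun k X => by
      rw [trMulLeft_apply, trMulLeft_apply, ← mul_assoc, hW, (hc.rotated hU).exp_mul_star a k,
        smul_mul_assoc, tr_smul, mul_assoc, tr_mul_comm (star _), mul_assoc])
    (star_eq_sum_star_rotated c hU) (hc.star_mul_star_rotated U) (hc.mul_star_rotated U) f f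
  rw [trMulLeft_apply, trMulLeft_apply, mul_one, ← List.prod_ofFn_number (fun i => star (c i)) c hc.anticomm
    (fun i j hij => by rw [hc.anticomm_mixed, if_neg hij]) f hf] at key
  change tr (W * (List.ofFn fun i => star (c (f i)) * c (f i)).prod) = _
  -- `wick` puts the conjugated entries of `U` on the row index, whereas the kernel has them on the
  -- column index.
  rw [key, ← Matrix.det_transpose]
  congr 2
  ext i j
  simp only [Matrix.transpose_apply, Matrix.of_apply, Matrix.submatrix_apply,
    Matrix.mul_diagonal_mul_conjTranspose_apply]
  refine Finset.sum_congr rfl fun k _ => ?_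
  have h : ((Real.sigmoid (-a k) : ℝ) : ℂ) =
      (Real.exp (-a k) : ℂ) / (1 + (Real.exp (-a k) : ℂ)) := by
    rw [Real.sigmoid_def, neg_neg]
    norm_cast
    have := (hpos k).ne'
    rw [Real.exp_neg] at this ⊢
    have h0 := (Real.exp_pos (a k)).ne'
    have h1 : (1 : ℝ) + Real.exp (a k) ≠ 0 := by positivity
    field_simp
    ring
  rw [h]
  ring

end GibbsState

end Fermion

/-! ### Measures carried by a finite set. -/

section FiniteSupport

variable {α : Type*} [MeasurableSpace α] [MeasurableSingletonClass α]

open scoped Classical in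
theorem MeasureTheory.measureReal_eq_sum_of_ae_mem_finset (ν : Measure α) [IsFiniteMeasure ν]
    {F : Finset α} (hF : ∀ᵐ x ∂ν, x ∈ F) (s : Set α) :
    ν.real s = ∑ x ∈ F with x ∈ s, ν.real {x} := by
  rw [sum_measureReal_singleton]
  refine measureReal_congr ?_
  filter_upwards [hF] with x hx
  change (x ∈ s) = (x ∈ (↑(F.filter (· ∈ s)) : Set α))
  simp [hx]

theorem MeasureTheory.Measure.ext_of_ae_mem_finset {ν ν' : Measure α} [IsFiniteMeasure ν]
    [IsFiniteMeasure ν'] {F : Finset α} (hF : ∀ᵐ x ∂ν, x ∈ F) (hF' : ∀ᵐ x ∂ν', x ∈ F)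
    (h : ∀ x ∈ F, ν.real {x} = ν'.real {x}) : ν = ν' := by
  classical
  ext s _
  rw [← ENNReal.toReal_eq_toReal_iff' (measure_ne_top _ _) (measure_ne_top _ _)]
  change ν.real s = ν'.real s
  rw [measureReal_eq_sum_of_ae_mem_finset ν hF, measureReal_eq_sum_of_ae_mem_finset ν' hF']
  exact Finset.sum_congr rfl fun x hx => h x (Finset.mem_filter.1 hx).1

theorem MeasureTheory.exists_isProbabilityMeasure_of_sum_eq_one (F : Finset α) (q : α → ℝ)
    (h0 : ∀ x, 0 ≤ q x) (hq : ∀ x ∉ F, q x = 0) (hsum : ∑ x ∈ F, q x = 1) :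
    ∃ ν : Measure α, IsProbabilityMeasure ν ∧ (∀ᵐ x ∂ν, x ∈ F) ∧ ∀ x, ν.real {x} = q x := by
  let p : PMF α := PMF.ofFinset (fun x => ENNReal.ofReal (q x)) F
    (by rw [← ENNReal.ofReal_sum_of_nonneg fun x _ => h0 x, hsum, ENNReal.ofReal_one])
    (fun x hx => by rw [hq x hx, ENNReal.ofReal_zero])
  refine ⟨p.toMeasure, PMF.toMeasure.isProbabilityMeasure p, ?_, fun x => ?_⟩
  · rw [ae_iff, PMF.toMeasure_apply_eq_zero_iff p (by exact F.measurableSet.compl),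
      Set.disjoint_left]
    intro x hx hxF
    rw [PMF.mem_support_iff, PMF.ofFinset_apply, hq x hxF] at hx
    simp at hx
  · rw [measureReal_def, PMF.toMeasure_apply_singleton _ _ (measurableSet_singleton x),
      PMF.ofFinset_apply, ENNReal.toReal_ofReal (h0 x)]

end FiniteSupport

section ListProd

theorem List.prod_map_ite_one {ι M : Type*} [Monoid M] (p : ι → Prop) [DecidablePred p]
    (g : ι → M) (l : List ι) :
    (l.map fun i => if p i then g i else 1).prod = ((l.filter (fun i => p i)).map g).prod := by
  induction l with
  | nil => rfl
  | cons i l ih => by_cases h : p i <;> simp [h, ih]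

open scoped Classical in
/-- Summing an ordered product of partitions of unity over the choices with prescribed values
on `S`. -/
theorem List.sum_piFinset_prod_ofFn {A α : Type*} [Ring A] [Algebra ℂ A] {n : ℕ}
    (B : Finset α) (Q : Fin n → α → A) (hQ : ∀ i, ∑ x ∈ B, Q i x = 1) (S : Finset (Fin n))
    (t : Fin n → α) (ht : ∀ i ∈ S, t i ∈ B) :
    ∑ x ∈ Fintype.piFinset (fun _ : Fin n => B) with ∀ i ∈ S, x i = t i,
        (List.ofFn fun i => Q i (x i)).prod =
      (((List.finRange n).filter (fun i => i ∈ S)).map fun i => Q i (t i)).prod := by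
  -- The constrained box is again a box, so multilinearity applies; each factor outside `S` then
  -- sums to `1`.
  have h1 : (Fintype.piFinset (fun _ : Fin n => B)).filter (fun x => ∀ i ∈ S, x i = t i) =
      Fintype.piFinset fun i => if i ∈ S then {t i} else B := by
    ext x
    simp only [Finset.mem_filter, Fintype.mem_piFinset]
    refine ⟨fun h i => ?_, fun h => ⟨fun i => ?_, fun i hi => ?_⟩⟩
    · split_ifs with hi
      · exact Finset.mem_singleton.2 (h.2 i hi)
      · exact h.1 i
    · have := h i
      split_ifs at this with hi
      · rw [Finset.mem_singleton.1 this]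
        exact ht i hi
      · exact this
    · simpa [hi] using h i
  have h2 := MultilinearMap.map_sum_finset (MultilinearMap.mkPiAlgebraFin ℂ n A) Q
    (fun i => if i ∈ S then {t i} else B)
  simp only [MultilinearMap.mkPiAlgebraFin_apply] at h2
  rw [h1, ← h2, List.ofFn_eq_map, ← List.prod_map_ite_one]
  congr 2
  ext i
  split_ifs
  · simp
  · exact hQ i

end ListProd

namespace Fermion

variable {E : Type*} [NormedAddCommGroup E] [InnerProductSpace ℂ E] [CompleteSpace E]

/-! ### Spectral projections of an orthogonal projection. -/

section SpecProj

theorem specProj_eq_starProjection {A : E →L[ℂ] E} {x : ℝ} {K : Submodule ℂ E}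
    [K.HasOrthogonalProjection] (h : Module.End.eigenspace (A : E →ₗ[ℂ] E) (x : ℂ) = K) :
    specProj A x = K.starProjection := by
  subst h
  rfl

theorem specProj_one {P : E →L[ℂ] E} (hP : IsStarProjection P) : specProj P 1 = P := by
  obtain ⟨K, _, rfl⟩ := isStarProjection_iff_eq_starProjection.1 hP
  refine specProj_eq_starProjection ?_
  ext v
  rw [Module.End.mem_eigenspace_iff]
  simpa using Submodule.starProjection_eq_self_iff

theorem specProj_zero {P : E →L[ℂ] E} (hP : IsStarProjection P) : specProj P 0 = 1 - P := by
  obtain ⟨K, _, rfl⟩ := isStarProjection_iff_eq_starProjection.1 hP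
  have h : Module.End.eigenspace (K.starProjection : E →ₗ[ℂ] E) ((0 : ℝ) : ℂ) = Kᗮ := by
    ext v
    rw [Module.End.mem_eigenspace_iff]
    simpa using Submodule.starProjection_apply_eq_zero_iff K
  rw [specProj_eq_starProjection h, Submodule.starProjection_orthogonal']

theorem hasEigenvalue_iff_specProj_ne_zero {A : E →L[ℂ] E} {x : ℝ} :
    Module.End.HasEigenvalue (A : E →ₗ[ℂ] E) (x : ℂ) ↔ specProj A x ≠ 0 := by
  rw [Module.End.hasEigenvalue_iff, not_iff_not]
  constructor
  · intro h
    rw [specProj_eq_starProjection h, Submodule.starProjection_bot]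
  · intro h
    rw [specProj] at h
    rw [← Submodule.range_starProjection (Module.End.eigenspace (A : E →ₗ[ℂ] E) (x : ℂ)), h]
    exact LinearMap.range_zero

theorem eq_zero_or_one_of_hasEigenvalue {P : E →L[ℂ] E} (hP : IsStarProjection P) {x : ℝ}
    (hx : Module.End.HasEigenvalue (P : E →ₗ[ℂ] E) (x : ℂ)) : x = 0 ∨ x = 1 := by
  obtain ⟨v, hv⟩ := hx.exists_hasEigenvector
  have h1 : P v = (x : ℂ) • v := hv.apply_eq_smul
  have h2 : P (P v) = P v := congrArg (fun Z : E →L[ℂ] E => Z v) hP.isIdempotentElem.eq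
  rw [h1, map_smul, h1, smul_smul] at h2
  have h3 := smul_left_injective ℂ hv.2 h2
  have h4 : x * x = x := by exact_mod_cast h3
  have h5 : x * (x - 1) = 0 := by linear_combination h4
  rcases mul_eq_zero.1 h5 with h | h
  · exact Or.inl h
  · exact Or.inr (by linarith)

theorem specProj_eq_zero {P : E →L[ℂ] E} (hP : IsStarProjection P) {x : ℝ} (h0 : x ≠ 0)
    (h1 : x ≠ 1) : specProj P x = 0 := by
  by_contra h
  rcases eq_zero_or_one_of_hasEigenvalue hP (hasEigenvalue_iff_specProj_ne_zero.2 h) with h | h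
  · exact h0 h
  · exact h1 h

theorem sum_specProj {P : E →L[ℂ] E} (hP : IsStarProjection P) :
    ∑ x ∈ ({0, 1} : Finset ℝ), specProj P x = 1 := by
  rw [Finset.sum_pair zero_ne_one, specProj_one hP, specProj_zero hP, sub_add_cancel]

/-- The spectral projections of `P` are only `P`, `1 - P` and `0`. -/
theorem commute_specProj {P Q : E →L[ℂ] E} (hP : IsStarProjection P) (hQ : IsStarProjection Q)
    (h : Commute P Q) (x y : ℝ) : Commute (specProj P x) (specProj Q y) := by
  have key (R : E →L[ℂ] E) {P : E →L[ℂ] E} (hP : IsStarProjection P) (h : Commute R P) (x : ℝ) :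
      Commute R (specProj P x) := by
    by_cases h0 : x = 0
    · rw [h0, specProj_zero hP]
      exact (Commute.one_right R).sub_right h
    by_cases h1 : x = 1
    · rwa [h1, specProj_one hP]
    · rw [specProj_eq_zero hP h0 h1]
      exact Commute.zero_right R
  exact key _ hQ (key _ hP h.symm x).symm y

end SpecProj

theorem isStarProjection_list_prod {R ι : Type*} [Ring R] [StarRing R] (l : List ι) (g : ι → R)
    (hg : ∀ i, IsStarProjection (g i)) (hcomm : ∀ i j, Commute (g i) (g j)) :
    IsStarProjection (l.map g).prod := by
  induction l with
  | nil => exact IsStarProjection.one R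
  | cons i l ih =>
    rw [List.map_cons, List.prod_cons]
    refine (hg i).mul ih (Commute.list_prod_right _ _ fun x hx => ?_)
    obtain ⟨j, _, rfl⟩ := List.mem_map.1 hx
    exact hcomm i j

theorem ae_mem_pair_of_isBornLaw {ρ P : E →L[ℂ] E} (hP : IsStarProjection P) {ν : Measure ℝ}
    (hν : IsBornLaw ρ P ν) : ∀ᵐ x ∂ν, x ∈ ({0, 1} : Finset ℝ) := by
  filter_upwards [hν.2.1] with x hx
  simpa using eq_zero_or_one_of_hasEigenvalue hP hx

theorem IsBornLaw.unique {ρ P : E →L[ℂ] E} (hP : IsStarProjection P) {ν ν' : Measure ℝ}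
    (hν : IsBornLaw ρ P ν) (hν' : IsBornLaw ρ P ν') : ν' = ν := by
  have := hν.1
  have := hν'.1
  refine Measure.ext_of_ae_mem_finset (ae_mem_pair_of_isBornLaw hP hν')
    (ae_mem_pair_of_isBornLaw hP hν) fun x _ => ?_
  exact_mod_cast (hν'.2.2 x).trans (hν.2.2 x).symm

/-! ### Joint measurement of commuting projections. -/

section Joint

variable {N : ℕ} {ρ : E →L[ℂ] E} {P : Fin N → E →L[ℂ] E}

theorem ae_mem_piFinset_of_isJointBornLaw (hP : ∀ i, IsStarProjection (P i))
    {ν : Measure (Fin N → ℝ)} (hν : IsJointBornLaw ρ P ν) :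
    ∀ᵐ x ∂ν, x ∈ Fintype.piFinset fun _ : Fin N => ({0, 1} : Finset ℝ) := by
  filter_upwards [hν.2.1] with x hx
  simpa [Fintype.mem_piFinset] using fun i => eq_zero_or_one_of_hasEigenvalue (hP i) (hx i)

theorem IsJointBornLaw.unique (hP : ∀ i, IsStarProjection (P i)) {ν ν' : Measure (Fin N → ℝ)}
    (hν : IsJointBornLaw ρ P ν) (hν' : IsJointBornLaw ρ P ν') : ν' = ν := by
  have := hν.1
  have := hν'.1
  refine Measure.ext_of_ae_mem_finset (ae_mem_piFinset_of_isJointBornLaw hP hν')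
    (ae_mem_piFinset_of_isJointBornLaw hP hν) fun x _ => ?_
  exact_mod_cast (hν'.2.2 x).trans (hν.2.2 x).symm

/-- The probability of prescribing the outcomes of the measurements in `S`. -/
theorem IsJointBornLaw.measureReal_cylinder (hP : ∀ i, IsStarProjection (P i))
    {ν : Measure (Fin N → ℝ)} (hν : IsJointBornLaw ρ P ν) (S : Finset (Fin N)) (t : Fin N → ℝ)
    (ht : ∀ i ∈ S, t i ∈ ({0, 1} : Finset ℝ)) :
    ((ν.real {x | ∀ i ∈ S, x i = t i} : ℝ) : ℂ) =
      tr (ρ * (((List.finRange N).filter (fun i => i ∈ S)).map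
        fun i => specProj (P i) (t i)).prod) := by
  classical
  have := hν.1
  rw [measureReal_eq_sum_of_ae_mem_finset ν (ae_mem_piFinset_of_isJointBornLaw hP hν)]
  push_cast
  simp only [hν.2.2, Set.mem_ofPred_eq]
  have := List.sum_piFinset_prod_ofFn {0, 1} (fun i => specProj (P i))
    (fun i => sum_specProj (hP i)) S t ht
  rw [← trMulLeft_apply, ← this, map_sum]
  rfl

open scoped ComplexOrder in
-- A product of commuting projections is a projection, so the weights are nonnegative. Excluding `P
-- i = 0` and `P i = 1` makes both `0` and `1` eigenvalues, so the law lives on the product of the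
-- spectra.
theorem exists_isJointBornLaw (hρ : IsState ρ) (hP : ∀ i, IsStarProjection (P i))
    (hcomm : ∀ i j, Commute (P i) (P j)) (h0 : ∀ i, P i ≠ 0) (h1 : ∀ i, P i ≠ 1) :
    ∃ ν, IsJointBornLaw ρ P ν := by
  classical
  set F := Fintype.piFinset fun _ : Fin N => ({0, 1} : Finset ℝ) with hF
  set w : (Fin N → ℝ) → ℂ :=
    fun x => tr (ρ * (List.ofFn fun i => specProj (P i) (x i)).prod) with hw
  have hpos (x : Fin N → ℝ) : 0 ≤ w x := by
    refine tr_mul_nonneg hρ.1 ?_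
    rw [List.ofFn_eq_map]
    exact isStarProjection_list_prod _ _ (fun i => isStarProjection_starProjection)
      fun i j => commute_specProj (hP i) (hP j) (hcomm i j) _ _
  have hre (x : Fin N → ℝ) : (((w x).re : ℝ) : ℂ) = w x :=
    Complex.ext rfl (by simpa using (Complex.nonneg_iff.1 (hpos x)).2)
  have hout (x : Fin N → ℝ) (hx : x ∉ F) : w x = 0 := by
    obtain ⟨i, hi⟩ : ∃ i, x i ∉ ({0, 1} : Finset ℝ) := by
      simpa [hF, Fintype.mem_piFinset] using hx
    simp only [Finset.mem_insert, Finset.mem_singleton, not_or] at hi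
    have : (List.ofFn fun i => specProj (P i) (x i)).prod = 0 :=
      List.prod_eq_zero ((List.mem_ofFn' _ _).2 ⟨i, specProj_eq_zero (hP i) hi.1 hi.2⟩)
    simp [hw, this, tr]
  have hsum : ∑ x ∈ F, w x = 1 := by
    -- With nothing prescribed (`S = ∅`), the sum runs over the whole box; the value `0` for `t` is
    -- a dummy.
    have := List.sum_piFinset_prod_ofFn {0, 1} (fun i => specProj (P i))
      (fun i => sum_specProj (hP i)) ∅ 0 (by simp)
    simp only [Finset.notMem_empty, false_imp_iff, imp_true_iff, Finset.filter_true] at this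
    simp only [hw, ← trMulLeft_apply, ← map_sum]
    rw [hF, this, trMulLeft_apply]
    simpa using hρ.2
  obtain ⟨ν, hν, hae, hs⟩ := exists_isProbabilityMeasure_of_sum_eq_one F (fun x => (w x).re)
    (fun x => (Complex.nonneg_iff.1 (hpos x)).1) (fun x hx => by rw [hout x hx, Complex.zero_re])
    (by rw [← Complex.re_sum, hsum, Complex.one_re])
  refine ⟨ν, hν, ?_, fun x => ?_⟩
  · filter_upwards [hae] with x hx i
    have hi := Fintype.mem_piFinset.1 hx i
    simp only [Finset.mem_insert, Finset.mem_singleton] at hi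
    rw [hasEigenvalue_iff_specProj_ne_zero]
    rcases hi with hi | hi
    · rw [hi, specProj_zero (hP i)]
      exact sub_ne_zero.2 (h1 i).symm
    · rw [hi, specProj_one (hP i)]
      exact h0 i
  · rw [hs, hre]

theorem IsJointBornLaw.map_apply (hP : ∀ i, IsStarProjection (P i)) {ν : Measure (Fin N → ℝ)}
    (hν : IsJointBornLaw ρ P ν) (h0 : ∀ i, P i ≠ 0) (h1 : ∀ i, P i ≠ 1) (i : Fin N) :
    IsBornLaw ρ (P i) (ν.map fun x => x i) := by
  have := hν.1
  have hm : Measurable fun x : Fin N → ℝ => x i := measurable_pi_apply i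
  have hae : ∀ᵐ x ∂(ν.map fun x => x i), x ∈ ({0, 1} : Finset ℝ) := by
    refine (ae_map_iff hm.aemeasurable (Finset.measurableSet {0, 1})).2 ?_
    filter_upwards [ae_mem_piFinset_of_isJointBornLaw hP hν] with x hx
    exact Fintype.mem_piFinset.1 hx i
  refine ⟨Measure.isProbabilityMeasure_map hm.aemeasurable, ?_, fun x => ?_⟩
  · filter_upwards [hae] with x hx
    simp only [Finset.mem_insert, Finset.mem_singleton] at hx
    rw [hasEigenvalue_iff_specProj_ne_zero]
    rcases hx with rfl | rfl
    · rw [specProj_zero (hP i)]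
      exact sub_ne_zero.2 (h1 i).symm
    · rw [specProj_one (hP i)]
      exact h0 i
  · by_cases hx : x ∈ ({0, 1} : Finset ℝ)
    · rw [map_measureReal_apply hm (measurableSet_singleton x)]
      have := hν.measureReal_cylinder hP {i} (fun _ => x) fun _ _ => hx
      simp only [Finset.mem_singleton, forall_eq] at this
      rw [List.filter_eq, List.count_eq_one_of_mem (List.nodup_finRange N) (List.mem_finRange i),
        List.replicate_one, List.map_singleton, List.prod_singleton] at this
      exact this
    · have h2 : (ν.map fun x => x i).real {x} = 0 := by
        rw [measureReal_def, measure_mono_null _ (ae_iff.1 hae), ENNReal.toReal_zero]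
        rintro y rfl
        exact hx
      simp only [Finset.mem_insert, Finset.mem_singleton, not_or] at hx
      rw [h2, specProj_eq_zero (hP i) hx.1 hx.2]
      simp [tr]

end Joint

end Fermion

section Kernel

/-- Permuting rows and columns simultaneously preserves the determinant; this passes from the
ordered operator product to indexing by `S`. -/
theorem Matrix.det_submatrix_filter_finRange {N : ℕ} (K : Matrix (Fin N) (Fin N) ℂ)
    (S : Finset (Fin N)) :
    (K.submatrix ((List.finRange N).filter (fun i => i ∈ S)).get
        ((List.finRange N).filter (fun i => i ∈ S)).get).det =
      (K.submatrix (fun i : S => (i : Fin N)) (fun j : S => (j : Fin N))).det := by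
  have hl : ((List.finRange N).filter (fun i => i ∈ S)).Nodup := (List.nodup_finRange N).filter _
  let e := (hl.getEquiv _).trans (Equiv.subtypeEquivRight (q := fun i => i ∈ S) fun i => by simp)
  rw [← Matrix.det_submatrix_equiv_self e (K.submatrix _ _)]
  rfl

end Kernel

/-- Either equality would force $c_i=0$, through $c_i^*c_i=0$ or $c_ic_i^*=0$, contradicting
$\{c_i,c_i^*\}=1\neq0$. -/
theorem Fermion.IsCAR.number_ne_zero_and_ne_one {E : Type*} [NormedAddCommGroup E]
    [InnerProductSpace ℂ E] [CompleteSpace E] [Nontrivial E] {N : ℕ} {c : Fin N → E →L[ℂ] E}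
    (hc : Fermion.IsCAR c) (i : Fin N) : Fermion.number c i ≠ 0 ∧ Fermion.number c i ≠ 1 := by
  have hmix : c i * star (c i) + star (c i) * c i = 1 := by simpa using hc.anticomm_mixed i i
  have h1 : c i ≠ 0 := by
    intro h
    simp [h] at hmix
  constructor
  · intro h
    exact h1 (CStarRing.star_mul_self_eq_zero_iff _ |>.1 h)
  · intro h
    rw [Fermion.number] at h
    rw [h, add_eq_right] at hmix
    exact h1 (CStarRing.mul_star_self_eq_zero_iff _ |>.1 hmix)

theorem mainTheorem3 {N : ℕ}
    {E : Type*} [NormedAddCommGroup E] [InnerProductSpace ℂ E] [FiniteDimensional ℂ E]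
    [CompleteSpace E] (hE : Module.finrank ℂ E = 2 ^ N)
    (c : Fin N → E →L[ℂ] E) (hc : Fermion.IsCAR c)
    (H : Matrix (Fin N) (Fin N) ℂ) (hH : H.IsHermitian)
    (U : Matrix (Fin N) (Fin N) ℂ) (hU : U ∈ Matrix.unitaryGroup (Fin N) ℂ)
    (lam : Fin N → ℝ)
    (hdiag : H = U * Matrix.diagonal (fun k => (lam k : ℂ)) * U.conjTranspose)
    (β μ : ℝ) (hβ : 0 < β) (hμ : 0 ≤ μ)
    (ρ : E →L[ℂ] E)
    (hρ : ρ = Fermion.gibbsState β μ (Fermion.hamiltonian c H) (Fermion.rotated c U)) :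
    -- `ρ` is a mixed state
    Fermion.IsState ρ ∧
    -- each `N_i` is an orthogonal projector, and the outcome of measuring it is `0` or `1`
    (∀ i, IsStarProjection (Fermion.number c i)) ∧
    (∀ i, ∃ ν : Measure ℝ, Fermion.IsBornLaw ρ (Fermion.number c i) ν ∧
      (∀ ν', Fermion.IsBornLaw ρ (Fermion.number c i) ν' → ν' = ν) ∧
      ∀ᵐ x ∂ν, x = 0 ∨ x = 1) ∧
    -- the `N_i` commute pairwise
    (∀ i j, Commute (Fermion.number c i) (Fermion.number c j)) ∧
    -- Born's rule defines the law `ν` of a Boolean vector, with the laws above as its marginals,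
    -- and the random set of the indices of its ones is determinantal
    ∃ ν : Measure (Fin N → ℝ), Fermion.IsJointBornLaw ρ (Fermion.number c) ν ∧
      (∀ ν', Fermion.IsJointBornLaw ρ (Fermion.number c) ν' → ν' = ν) ∧
      (∀ᵐ x ∂ν, ∀ i, x i = 0 ∨ x i = 1) ∧
      (∀ i, Fermion.IsBornLaw ρ (Fermion.number c i) (ν.map fun x => x i)) ∧
      IsDPP
        (U * Matrix.diagonal (fun k => ((Real.sigmoid (-β * (lam k - μ)) : ℝ) : ℂ))
          * U.conjTranspose)
        (ν.map fun x => {i : Fin N | x i = 1}) := by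
  have : Nontrivial E := Module.nontrivial_of_finrank_pos (R := ℂ) (by rw [hE]; positivity)
  have hP := hc.isStarProjection_number
  have h0 (i : Fin N) := (hc.number_ne_zero_and_ne_one i).1
  have h1 (i : Fin N) := (hc.number_ne_zero_and_ne_one i).2
  rw [Fermion.gibbsState, hdiag, Fermion.gibbsWeight_diagonalized] at hρ
  obtain ⟨hZ, hstate⟩ := Fermion.isState_normalize_exp
    (Fermion.isSelfAdjoint_neg_sum_number (Fermion.rotated c U) fun k => β * (lam k - μ))
  rw [← hρ] at hstate
  obtain ⟨ν, hν⟩ := Fermion.exists_isJointBornLaw hstate hP hc.commute_number h0 h1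
  have hmarg := hν.map_apply hP h0 h1
  -- The one-observable laws are obtained as marginals of the joint law.
  refine ⟨hstate, hP, fun i => ⟨_, hmarg i, fun ν' h => (hmarg i).unique (hP i) h, ?_⟩,
    hc.commute_number, ν, hν, fun ν' h => hν.unique hP h, ?_, hmarg, ?_, fun S => ?_⟩
  · filter_upwards [Fermion.ae_mem_pair_of_isBornLaw (hP i) (hmarg i)] with x hx
    simpa using hx
  · filter_upwards [Fermion.ae_mem_piFinset_of_isJointBornLaw hP hν] with x hx i
    simpa using Fintype.mem_piFinset.1 hx i
  all_goals
    have hm : Measurable fun x : Fin N → ℝ => {i : Fin N | x i = 1} :=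
      measurable_set_iff.2 fun i =>
        (measurableSet_eq_fun (measurable_pi_apply i) measurable_const).mem
  · have := hν.1
    exact Measure.isProbabilityMeasure_map hm.aemeasurable
  · have hS : MeasurableSet {Y : Set (Fin N) | (S : Set (Fin N)) ⊆ Y} :=
      (Set.toFinite _).measurableSet
    rw [map_measureReal_apply hm hS]
    have hcyl := hν.measureReal_cylinder hP S (fun _ => 1) (by simp)
    refine Eq.trans ?_ (hcyl.trans ?_)
    -- The event $S\subseteq Y$ is by definition the cylinder $x_i=1$ for $i\in S$.
    · rfl
    · have hl : ((List.finRange N).filter (fun i => i ∈ S)).Nodup :=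
        (List.nodup_finRange N).filter _
      have key := hc.tr_gibbs_mul_prod_number hU (fun k => β * (lam k - μ))
        ((List.finRange N).filter (fun i => i ∈ S)).get hl.injective_get
      have hmap : ((List.finRange N).filter (fun i => i ∈ S)).map
            (fun i => Fermion.specProj (Fermion.number c i) 1) =
          List.ofFn fun j =>
            Fermion.number c (((List.finRange N).filter (fun i => i ∈ S)).get j) := by
        simp only [Fermion.specProj_one (hP _)]
        conv_lhs => rw [← List.ofFn_get ((List.finRange N).filter (fun i => i ∈ S)), List.map_ofFn]
        rfl
      rw [hmap, hρ, smul_mul_assoc, Fermion.tr_smul, key, mul_comm _ (Fermion.tr _),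
        inv_mul_cancel_left₀ hZ, Matrix.det_submatrix_filter_finRange]
      simp only [neg_mul]
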